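/- For $\alpha\in(0,1]$ let $\gamma(\alpha;\eta)=\int_0^\eta e^{-w}w^{\alpha-1}\,dw$ be the lower incomplete gamma function, and let $S_\alpha=\{S_\alpha(t),t\ge 0\}$ be a subordinator (a real Lévy process with almost surely non-decreasing paths) with Laplace exponent $\alpha\gamma(\alpha;\eta)$, that is, $$\mathbb{E}\,e^{-\eta S_\alpha(t)}=e^{-t\alpha\gamma(\alpha;\eta)},\qquad t,\eta\ge 0 .$$ Here $f\sim g$ means $f=g+o(g)$ (so $f/g\to1$ when $g$ is eventually non-zero, and $f$ is eventually zero when $g$ is). 1) Let $\alpha\in(0,1)$. Then for every $t\ge 0$, $$P(S_\alpha(t)>x)\sim\frac{t\,x^{-\alpha}}{\Gamma(1-\alpha)},\qquad x\to+\infty .$$ 2) Let $\alpha\in(0,1]$ and $0<p<\alpha$. Then the fractional moment $\mathbb{E}\,S_\alpha(t)^p$ is finite for every $t\ge 0$, and $$\mathbb{E}\,S_\alpha(t)^p\sim\frac{\Gamma(1-p/\alpha)}{\Gamma(1-p)}\,t^{p/\alpha},\qquad t\to+\infty .$$ In the boundary case $p=\alpha=1$, the moment $\mathbb{E}\,S_1(t)$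 is also finite for every $t\ge0$ and $\mathbb{E}\,S_1(t)\sim t$ as $t\to+\infty$ (the formula above, with the quotient $\Gamma(1-p/\alpha)/\Gamma(1-p)$ replaced by its value $1$ for $\alpha=1$, $p<1$). -/

import Mathlib

open MeasureTheory ProbabilityTheory Filter Topology Asymptotics
open scoped NNReal

/-- A real-valued Lévy process indexed by `[0, ∞)`: it starts at `0`, has independent and
stationary increments, is stochastically continuous, and its paths are almost surely
right-continuous with left limits. -/
structure IsLevyProcess {Ω : Type*} [MeasurableSpace Ω] (X : ℝ≥0 → Ω → ℝ) (P : Measure Ω) :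
    Prop where
  measurable : ∀ t, Measurable (X t)
  zero : ∀ᵐ ω ∂P, X 0 ω = 0
  indepIncrements : HasIndepIncrements X P
  stationaryIncrements : ∀ s h : ℝ≥0,
    IdentDistrib (fun ω ↦ X (s + h) ω - X s ω) (fun ω ↦ X h ω - X 0 ω) P P
  stochasticallyContinuous : ∀ t, TendstoInMeasure P X (𝓝 t) (X t)
  rightContinuous : ∀ᵐ ω ∂P, ∀ t, ContinuousWithinAt (fun s ↦ X s ω) (Set.Ici t) t
  leftLimits : ∀ᵐ ω ∂P, ∀ t, ∃ l : ℝ, Tendsto (fun s ↦ X s ω) (𝓝[<] t) (𝓝 l)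

/-- A subordinator: a Lévy process whose paths are almost surely non-decreasing. -/
structure IsSubordinator {Ω : Type*} [MeasurableSpace Ω] (S : ℝ≥0 → Ω → ℝ) (P : Measure Ω) :
    Prop extends IsLevyProcess S P where
  monotone : ∀ᵐ ω ∂P, Monotone fun t ↦ S t ω

/-- `φ` is the Laplace exponent of `S`: `𝔼 exp(-η S(t)) = exp(-t φ(η))` for `t, η ≥ 0`. -/
def HasLaplaceExponent {Ω : Type*} [MeasurableSpace Ω] (S : ℝ≥0 → Ω → ℝ) (P : Measure Ω)
    (φ : ℝ → ℝ) : Prop :=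
  ∀ (t : ℝ≥0) (η : ℝ), 0 ≤ η →
    ∫ ω, Real.exp (-η * S t ω) ∂P = Real.exp (-(t : ℝ) * φ η)

/-- The lower incomplete gamma function `γ(α; x) = ∫₀ˣ e^{-w} w^{α-1} dw`. -/
noncomputable def lowerIncompleteGamma (α x : ℝ) : ℝ :=
  ∫ w in (0 : ℝ)..x, Real.exp (-w) * w ^ (α - 1)

/-- `S` is a version of the subordinator `S_α`, that is, the subordinator with Laplace exponent
`η ↦ α γ(α; η)`. -/
structure IsIncompleteGammaSubordinator {Ω : Type*} [MeasurableSpace Ω] (α : ℝ)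
    (S : ℝ≥0 → Ω → ℝ) (P : Measure Ω) : Prop extends IsSubordinator S P where
  laplaceExponent : HasLaplaceExponent S P fun η ↦ α * lowerIncompleteGamma α η

/-! ### Behaviour of the Laplace exponent near zero -/

section IncompleteGamma

variable {α η : ℝ}

/-! Near zero `α γ(α; η)` behaves like `η ^ α`, so at large scales the process looks like the
`α`-stable subordinator. The bound `α γ(α; η) ≤ η ^ α`, valid for every `η ≥ 0`, supplies the
dominating functions.

Tail: the function `y ↦ P(Y > y)` has Laplace transform `(1 - E exp (-η Y)) / η`. For `Y = S(t) /
x`, multiplied by `x ^ α`, this tends to `t η ^ (α - 1)`, the transform of `t y ^ (-α) / Γ(1 - α)`.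
Monotonicity of the tail upgrades this to convergence at `y = 1`: `tendsto_apply_one_of_laplace`,
proved by Karamata's polynomial approximation.

Moments: by `lintegral_rpow_eq_lintegral_laplace`, `Γ(1 - p) / p * E Y ^ p` is the integral of `(1 -
E exp (-η Y)) η ^ (-p - 1)`. For `Y = S(t) / t ^ (1 / α)` the integrand tends to its stable
counterpart `(1 - exp (-η ^ α)) η ^ (-p - 1)` and is dominated by it; the limit integral is `Γ(1 - p
/ α) / p`.

Mean: for `α = 1` the exponent has slope `1` at zero, hence `E S_1(t) = t` exactly. -/

lemma intervalIntegrable_exp_neg_mul_rpow (hα : 0 < α) (a b : ℝ) :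
    IntervalIntegrable (fun w : ℝ ↦ Real.exp (-w) * w ^ (α - 1)) volume a b :=
  (intervalIntegral.intervalIntegrable_rpow' (by linarith)).continuousOn_mul
    (by fun_prop)

lemma continuous_lowerIncompleteGamma (hα : 0 < α) : Continuous (lowerIncompleteGamma α) :=
  intervalIntegral.continuous_primitive (intervalIntegrable_exp_neg_mul_rpow hα) 0

lemma mul_integral_rpow_sub_one (hα : 0 < α) (η : ℝ) :
    α * ∫ w in (0 : ℝ)..η, w ^ (α - 1) = η ^ α := by
  rw [integral_rpow (Or.inl (by linarith)), sub_add_cancel, Real.zero_rpow hα.ne', sub_zero,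
    mul_div_cancel₀ _ hα.ne']

/-- On `[0, η]` the factor `exp (-w)` lies between `exp (-η)` and `1`; this bound and the next one
compare the integrand with multiples of `w ^ (α - 1)`. -/
lemma mul_lowerIncompleteGamma_le (hα : 0 < α) (hη : 0 ≤ η) :
    α * lowerIncompleteGamma α η ≤ η ^ α := by
  rw [← mul_integral_rpow_sub_one hα η]
  refine mul_le_mul_of_nonneg_left ?_ hα.le
  refine intervalIntegral.integral_mono_on hη (intervalIntegrable_exp_neg_mul_rpow hα 0 η)
    (intervalIntegral.intervalIntegrable_rpow' (by linarith)) fun w hw ↦ ?_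
  exact mul_le_of_le_one_left (Real.rpow_nonneg hw.1 _) (Real.exp_le_one_iff.2 (by linarith [hw.1]))

lemma exp_neg_mul_rpow_le_mul_lowerIncompleteGamma (hα : 0 < α) (hη : 0 ≤ η) :
    Real.exp (-η) * η ^ α ≤ α * lowerIncompleteGamma α η := by
  rw [← mul_integral_rpow_sub_one hα η, mul_left_comm, ← intervalIntegral.integral_const_mul]
  refine mul_le_mul_of_nonneg_left ?_ hα.le
  refine intervalIntegral.integral_mono_on hη
    ((intervalIntegral.intervalIntegrable_rpow' (by linarith)).const_mul _)
    (intervalIntegrable_exp_neg_mul_rpow hα 0 η) fun w hw ↦ ?_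
  exact mul_le_mul_of_nonneg_right (Real.exp_le_exp.2 (by linarith [hw.2]))
    (Real.rpow_nonneg hw.1 _)

/-- `α γ(α; k / r) ∼ (k / r) ^ α` as `r → ∞`. -/
lemma tendsto_rpow_mul_mul_lowerIncompleteGamma (hα : 0 < α) {k : ℝ} (hk : 0 ≤ k) :
    Tendsto (fun r : ℝ ↦ r ^ α * (α * lowerIncompleteGamma α (k / r))) atTop (𝓝 (k ^ α)) := by
  have hdiv : Tendsto (fun r : ℝ ↦ k / r) atTop (𝓝 0) := tendsto_id.const_div_atTop k
  have hlow : Tendsto (fun r : ℝ ↦ Real.exp (-(k / r)) * k ^ α) atTop (𝓝 (k ^ α)) := by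
    simpa using ((Real.continuous_exp.tendsto _).comp hdiv.neg).mul_const (k ^ α)
  have hsplit : ∀ r : ℝ, 0 < r → r ^ α * (k / r) ^ α = k ^ α := fun r hr ↦ by
    rw [← Real.mul_rpow hr.le (by positivity), mul_div_cancel₀ _ hr.ne']
  refine tendsto_of_tendsto_of_tendsto_of_le_of_le' hlow tendsto_const_nhds ?_ ?_
  · filter_upwards [eventually_gt_atTop 0] with r hr
    rw [← hsplit r hr, mul_left_comm]
    exact mul_le_mul_of_nonneg_left
      (exp_neg_mul_rpow_le_mul_lowerIncompleteGamma hα (by positivity)) (by positivity)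
  · filter_upwards [eventually_gt_atTop 0] with r hr
    rw [← hsplit r hr]
    exact mul_le_mul_of_nonneg_left (mul_lowerIncompleteGamma_le hα (by positivity))
      (by positivity)

end IncompleteGamma

/-! ### Moments and tails through the Laplace transform -/

section LaplaceTransform

open Set

lemma integral_exp_neg_zero (x : ℝ) : ∫ s in (0 : ℝ)..x, Real.exp (-s) = 1 - Real.exp (-x) := by
  simp

lemma lintegral_Ioi_rpow_neg {p c : ℝ} (hp : 0 < p) (hc : 0 < c) :
    ∫⁻ u in Ioi c, ENNReal.ofReal (u ^ (-p - 1)) = ENNReal.ofReal (c ^ (-p) / p) := by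
  rw [← ofReal_integral_eq_lintegral_ofReal (integrableOn_Ioi_rpow_of_lt (by linarith) hc)
    ((ae_restrict_iff' measurableSet_Ioi).2 <| .of_forall fun u hu ↦
      Real.rpow_nonneg (hc.trans hu).le _), integral_Ioi_rpow_of_lt (by linarith) hc]
  congr 1
  rw [sub_add_cancel, neg_div_neg_eq]

lemma lintegral_Ioi_rpow_mul_exp_neg {a : ℝ} (ha : 0 < a) :
    ∫⁻ s in Ioi (0 : ℝ), ENNReal.ofReal (s ^ (a - 1) * Real.exp (-s))
      = ENNReal.ofReal (Real.Gamma a) := by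
  have h := Real.integral_rpow_mul_exp_neg_mul_Ioi ha one_pos
  simp only [one_mul, div_one, Real.one_rpow] at h
  rw [← ofReal_integral_eq_lintegral_ofReal, h]
  · exact .of_integral_ne_zero (by rw [h]; exact (Real.Gamma_pos_of_pos ha).ne')
  · exact (ae_restrict_iff' measurableSet_Ioi).2 <| .of_forall fun s (hs : 0 < s) ↦ by positivity

/-- `∫₀^∞ (1 - exp (-x u^β)) u^{-p-1} du = Γ(1 - p/β) x^{p/β} / p` for `0 < p < β`. -/
lemma lintegral_one_sub_exp_neg_mul_rpow {p β x : ℝ} (hp : 0 < p) (hpβ : p < β) (hx : 0 ≤ x) :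
    ∫⁻ u in Ioi (0 : ℝ), ENNReal.ofReal ((1 - Real.exp (-(x * u ^ β))) * u ^ (-p - 1))
      = ENNReal.ofReal (Real.Gamma (1 - p / β) / p * x ^ (p / β)) := by
  have hβ : 0 < β := hp.trans hpβ
  have hq : p / β < 1 := (div_lt_one hβ).2 hpβ
  obtain rfl | hx := hx.eq_or_lt
  · simp [Real.zero_rpow (div_pos hp hβ).ne']
  set d : ℝ → ENNReal := fun u ↦ ENNReal.ofReal (u ^ (-p - 1)) with hd
  have hdm : Measurable d := by fun_prop
  set μ : Measure ℝ := (volume.restrict (Ioi 0)).withDensity d with hμ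
  have hac : μ ≪ volume.restrict (Ioi 0) := withDensity_absolutelyContinuous _ _
  have hfm : Measurable fun u : ℝ ↦ x * u ^ β := by fun_prop
  -- Layer cake for the measure `u ^ (-p - 1) du`: `1 - exp (-y)` is the primitive of `exp (-s)`, so
  -- only the mass of `{u | s < x u ^ β}` is needed.
  have hcake := lintegral_comp_eq_lintegral_meas_lt_mul μ (f := fun u ↦ x * u ^ β)
    (g := fun s ↦ Real.exp (-s))
    (hac.ae_le ((ae_restrict_iff' measurableSet_Ioi).2 <| .of_forall fun u (hu : 0 < u) ↦ by
      simp only [Pi.zero_apply]; positivity))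
    hfm.aemeasurable
    (fun t _ ↦ (by fun_prop : Continuous fun s : ℝ ↦ Real.exp (-s)).intervalIntegrable _ _)
    (.of_forall fun s ↦ (Real.exp_pos _).le)
  simp only [integral_exp_neg_zero] at hcake
  rw [hμ, lintegral_withDensity_eq_lintegral_mul _ hdm (by fun_prop)] at hcake
  have hL : ∫⁻ u in Ioi (0 : ℝ), ENNReal.ofReal ((1 - Real.exp (-(x * u ^ β))) * u ^ (-p - 1))
      = ∫⁻ u in Ioi (0 : ℝ),
        (d * fun u ↦ ENNReal.ofReal (1 - Real.exp (-(x * u ^ β)))) u := by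
    refine setLIntegral_congr_fun measurableSet_Ioi fun u (hu : 0 < u) ↦ ?_
    simp only [Pi.mul_apply, hd]
    rw [← ENNReal.ofReal_mul (by positivity), mul_comm]
  rw [hL, hcake]
  have hR : ∀ s ∈ Ioi (0 : ℝ),
      (volume.restrict (Ioi 0)).withDensity d {u | s < x * u ^ β} * ENNReal.ofReal (Real.exp (-s))
      = ENNReal.ofReal (x ^ (p / β) / p) *
        ENNReal.ofReal (s ^ ((1 - p / β) - 1) * Real.exp (-s)) := by
    intro s hs
    have hs : 0 < s := hs
    -- The superlevel set is a half-line of mass `(s / x) ^ (-p / β) / p`; integrating this against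
    -- `exp (-s)` gives the Gamma integral at `1 - p / β`.
    have hset : {u : ℝ | s < x * u ^ β} ∩ Ioi 0 = Ioi ((s / x) ^ (1 / β)) := by
      ext u
      simp only [mem_inter_iff, mem_ofPred_eq, mem_Ioi]
      have hpos : 0 < (s / x) ^ (1 / β) := by positivity
      constructor
      · rintro ⟨h, hu⟩
        rw [one_div, Real.rpow_inv_lt_iff_of_pos (by positivity) hu.le hβ, div_lt_iff₀' hx]
        exact h
      · intro h
        have hu := hpos.trans h
        rw [one_div, Real.rpow_inv_lt_iff_of_pos (by positivity) hu.le hβ, div_lt_iff₀' hx] at h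
        exact ⟨h, hu⟩
    rw [withDensity_apply _ (measurableSet_lt measurable_const hfm),
      Measure.restrict_restrict (measurableSet_lt measurable_const hfm), hset,
      lintegral_Ioi_rpow_neg hp (by positivity), ← ENNReal.ofReal_mul (by positivity),
      ← ENNReal.ofReal_mul (by positivity)]
    congr 1
    rw [← Real.rpow_mul (by positivity), show 1 / β * -p = -(p / β) by ring,
      show 1 - p / β - 1 = -(p / β) by ring, Real.div_rpow hs.le hx.le, Real.rpow_neg hx.le]
    field_simp
  rw [setLIntegral_congr_fun measurableSet_Ioi hR, lintegral_const_mul _ (by fun_prop),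
    lintegral_Ioi_rpow_mul_exp_neg (by linarith), ← ENNReal.ofReal_mul (by positivity)]
  congr 1
  ring

variable {Ω : Type*} [MeasurableSpace Ω] {P : Measure Ω} [IsProbabilityMeasure P] {Y : Ω → ℝ}

lemma integrable_exp_neg_mul (hY : Measurable Y) (hY0 : ∀ᵐ ω ∂P, 0 ≤ Y ω) {η : ℝ} (hη : 0 ≤ η) :
    Integrable (fun ω ↦ Real.exp (-η * Y ω)) P := by
  refine Integrable.of_bound (by fun_prop) 1 ?_
  filter_upwards [hY0] with ω hω
  rw [Real.norm_of_nonneg (Real.exp_pos _).le, Real.exp_le_one_iff]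
  nlinarith

lemma integral_one_sub_exp_neg_mul (hY : Measurable Y) (hY0 : ∀ᵐ ω ∂P, 0 ≤ Y ω) {η : ℝ}
    (hη : 0 ≤ η) :
    ∫ ω, (1 - Real.exp (-η * Y ω)) ∂P = 1 - ∫ ω, Real.exp (-η * Y ω) ∂P := by
  rw [integral_sub (integrable_const _) (integrable_exp_neg_mul hY hY0 hη)]
  simp

lemma one_sub_exp_neg_mul_nonneg {η y : ℝ} (hη : 0 ≤ η) (hy : 0 ≤ y) :
    0 ≤ 1 - Real.exp (-η * y) := by
  rw [sub_nonneg, Real.exp_le_one_iff]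
  nlinarith

lemma lintegral_one_sub_exp_neg_mul (hY : Measurable Y) (hY0 : ∀ᵐ ω ∂P, 0 ≤ Y ω) {η : ℝ}
    (hη : 0 ≤ η) :
    ∫⁻ ω, ENNReal.ofReal (1 - Real.exp (-η * Y ω)) ∂P
      = ENNReal.ofReal (1 - ∫ ω, Real.exp (-η * Y ω) ∂P) := by
  rw [← integral_one_sub_exp_neg_mul hY hY0 hη, ofReal_integral_eq_lintegral_ofReal
    (f := fun ω ↦ 1 - Real.exp (-η * Y ω))
    ((integrable_const _).sub (integrable_exp_neg_mul hY hY0 hη))]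
  filter_upwards [hY0] with ω hω using one_sub_exp_neg_mul_nonneg hη hω

/-- Fractional moments of a nonnegative random variable in terms of its Laplace transform. -/
lemma lintegral_rpow_eq_lintegral_laplace (hY : Measurable Y) (hY0 : ∀ᵐ ω ∂P, 0 ≤ Y ω) {p : ℝ}
    (hp : 0 < p) (hp1 : p < 1) :
    ENNReal.ofReal (Real.Gamma (1 - p) / p) * ∫⁻ ω, ENNReal.ofReal (Y ω ^ p) ∂P
      = ∫⁻ η in Ioi (0 : ℝ),
        ENNReal.ofReal ((1 - ∫ ω, Real.exp (-η * Y ω) ∂P) * η ^ (-p - 1)) := by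
  have hΓ : 0 < Real.Gamma (1 - p) := Real.Gamma_pos_of_pos (by linarith)
  calc _ = ∫⁻ ω, (∫⁻ η in Ioi (0 : ℝ),
        ENNReal.ofReal ((1 - Real.exp (-η * Y ω)) * η ^ (-p - 1))) ∂P := by
        rw [← lintegral_const_mul _ (by fun_prop)]
        refine lintegral_congr_ae ?_
        filter_upwards [hY0] with ω hω
        have h := lintegral_one_sub_exp_neg_mul_rpow hp hp1 hω
        simp only [Real.rpow_one, div_one] at h
        rw [← ENNReal.ofReal_mul (by positivity), ← h]
        simp only [neg_mul, mul_comm (Y ω)]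
    _ = ∫⁻ η in Ioi (0 : ℝ), ∫⁻ ω,
        ENNReal.ofReal ((1 - Real.exp (-η * Y ω)) * η ^ (-p - 1)) ∂P := by
        rw [lintegral_lintegral_swap]
        simp only [Function.uncurry_def]
        fun_prop
    _ = _ := by
        refine setLIntegral_congr_fun measurableSet_Ioi fun η (hη : 0 < η) ↦ ?_
        have hm : 0 ≤ η ^ (-p - 1) := by positivity
        simp only [ENNReal.ofReal_mul' hm]
        rw [lintegral_mul_const _ (by fun_prop), lintegral_one_sub_exp_neg_mul hY hY0 hη.le]

/-- The Laplace transform of the tail function of a nonnegative random variable. -/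
lemma lintegral_exp_neg_mul_meas_lt (hY : Measurable Y) (hY0 : ∀ᵐ ω ∂P, 0 ≤ Y ω) {η : ℝ}
    (hη : 0 < η) :
    ∫⁻ y in Ioi (0 : ℝ), ENNReal.ofReal (Real.exp (-η * y) * P.real {ω | y < Y ω})
      = ENNReal.ofReal ((1 - ∫ ω, Real.exp (-η * Y ω) ∂P) / η) := by
  have hcake := lintegral_comp_eq_lintegral_meas_lt_mul P (f := Y)
    (g := fun s ↦ Real.exp (-η * s)) hY0 hY.aemeasurable
    (fun t _ ↦ (by fun_prop : Continuous fun s : ℝ ↦ Real.exp (-η * s)).intervalIntegrable _ _)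
    (.of_forall fun s ↦ (Real.exp_pos _).le)
  have hprim : ∀ y : ℝ, ∫ s in (0 : ℝ)..y, Real.exp (-η * s) = (1 - Real.exp (-η * y)) / η := by
    intro y
    rw [intervalIntegral.integral_comp_mul_left (fun s ↦ Real.exp s) (neg_ne_zero.2 hη.ne')]
    simp only [integral_exp, smul_eq_mul, mul_zero, Real.exp_zero]
    field_simp
    ring
  simp only [hprim] at hcake
  calc _ = ∫⁻ y in Ioi (0 : ℝ), P {ω | y < Y ω} * ENNReal.ofReal (Real.exp (-η * y)) := by
        refine lintegral_congr fun y ↦ ?_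
        rw [mul_comm, ENNReal.ofReal_mul measureReal_nonneg, ofReal_measureReal]
    _ = _ := by
        rw [← hcake]
        simp only [ENNReal.ofReal_div_of_pos hη]
        simp only [div_eq_mul_inv]
        rw [lintegral_mul_const _ (by fun_prop), lintegral_one_sub_exp_neg_mul hY hY0 hη.le]

lemma measurable_measureReal_lt (Y : Ω → ℝ) : Measurable fun y : ℝ ↦ P.real {ω | y < Y ω} :=
  Antitone.measurable fun _ _ h ↦ measureReal_mono fun _ hω ↦ h.trans_lt hω

lemma integrableOn_exp_neg_mul_measureReal_lt {η : ℝ} (hη : 0 < η) :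
    IntegrableOn (fun y ↦ Real.exp (-η * y) * P.real {ω | y < Y ω}) (Ioi 0) := by
  refine (exp_neg_integrableOn_Ioi 0 hη).mono'
    (by have := measurable_measureReal_lt (P := P) Y; fun_prop) (.of_forall fun y ↦ ?_)
  rw [Real.norm_of_nonneg (by positivity)]
  exact mul_le_of_le_one_right (Real.exp_pos _).le measureReal_le_one

lemma integral_exp_neg_mul_measureReal_lt (hY : Measurable Y) (hY0 : ∀ᵐ ω ∂P, 0 ≤ Y ω) {η : ℝ}
    (hη : 0 < η) :
    ∫ y in Ioi (0 : ℝ), Real.exp (-η * y) * P.real {ω | y < Y ω}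
      = (1 - ∫ ω, Real.exp (-η * Y ω) ∂P) / η := by
  have h := lintegral_exp_neg_mul_meas_lt hY hY0 hη
  rw [← ofReal_integral_eq_lintegral_ofReal (integrableOn_exp_neg_mul_measureReal_lt hη)
    (.of_forall fun y ↦ by simp only [Pi.zero_apply]; positivity)] at h
  refine (ENNReal.ofReal_eq_ofReal_iff (integral_nonneg fun y ↦ by positivity) ?_).1 h
  rw [← integral_one_sub_exp_neg_mul hY hY0 hη.le]
  refine div_nonneg (integral_nonneg_of_ae ?_) hη.le
  filter_upwards [hY0] with ω hω using one_sub_exp_neg_mul_nonneg hη.le hω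

end LaplaceTransform

/-! ### A Tauberian theorem for monotone functions -/

section Tauberian

open Set

/-- Convergence of moments of densities on a bounded variable `e` implies convergence of the
integrals of all continuous functions of `e`. -/
lemma tendsto_integral_comp_mul_of_moments {E ι : Type*} [MeasurableSpace E] {μ : Measure E}
    {l : Filter ι} {e : E → ℝ} (he : Measurable e) (he01 : ∀ᵐ x ∂μ, e x ∈ Icc (0 : ℝ) 1)
    {F : ι → E → ℝ} {G : E → ℝ} (hF : ∀ i, Integrable (F i) μ) (hF0 : ∀ i, 0 ≤ᵐ[μ] F i)
    (hG : Integrable G μ) (hG0 : 0 ≤ᵐ[μ] G)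
    (hmom : ∀ k : ℕ, Tendsto (fun i ↦ ∫ x, e x ^ k * F i x ∂μ) l (𝓝 (∫ x, e x ^ k * G x ∂μ)))
    {g : ℝ → ℝ} (hg : Continuous g) :
    Tendsto (fun i ↦ ∫ x, g (e x) * F i x ∂μ) l (𝓝 (∫ x, g (e x) * G x ∂μ)) := by
  have hintegrable : ∀ h : ℝ → ℝ, Continuous h → ∀ H : E → ℝ, Integrable H μ →
      Integrable (fun x ↦ h (e x) * H x) μ := by
    intro h hh H hH
    obtain ⟨C, hC⟩ := isCompact_Icc.exists_bound_of_continuousOn (hh.continuousOn (s := Icc 0 1))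
    exact hH.bdd_mul (c := C) (hh.measurable.comp he).aestronglyMeasurable
      (he01.mono fun x hx ↦ hC _ hx)
  have hclose : ∀ (q : Polynomial ℝ) (δ : ℝ), (∀ x ∈ Icc (0 : ℝ) 1, |q.eval x - g x| < δ) →
      ∀ H : E → ℝ, Integrable H μ → 0 ≤ᵐ[μ] H →
      |∫ x, q.eval (e x) * H x ∂μ - ∫ x, g (e x) * H x ∂μ| ≤ δ * ∫ x, H x ∂μ := by
    intro q δ hq H hH hH0
    rw [← integral_sub (hintegrable _ q.continuous H hH) (hintegrable g hg H hH), ← integral_const_mul,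
      ← Real.norm_eq_abs]
    refine norm_integral_le_of_norm_le (hH.const_mul δ) ?_
    filter_upwards [he01, hH0] with x hx hx0
    have hx0 : 0 ≤ H x := hx0
    rw [← sub_mul, norm_mul, Real.norm_eq_abs, Real.norm_of_nonneg hx0]
    exact mul_le_mul_of_nonneg_right (hq _ hx).le hx0
  have hpoly : ∀ q : Polynomial ℝ, Tendsto (fun i ↦ ∫ x, q.eval (e x) * F i x ∂μ) l
      (𝓝 (∫ x, q.eval (e x) * G x ∂μ)) := by
    intro q
    have hexp : ∀ H : E → ℝ, Integrable H μ → ∫ x, q.eval (e x) * H x ∂μ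
        = ∑ k ∈ Finset.range (q.natDegree + 1), q.coeff k * ∫ x, e x ^ k * H x ∂μ := by
      intro H hH
      simp only [Polynomial.eval_eq_sum_range, Finset.sum_mul, mul_assoc]
      rw [integral_finsetSum]
      · simp only [integral_const_mul]
      · exact fun k _ ↦ (hintegrable (fun v ↦ v ^ k) (by fun_prop) H hH).const_mul _
    simp only [hexp _ (hF _), hexp _ hG]
    exact tendsto_finsetSum _ fun k _ ↦ (hmom k).const_mul _
  rw [Metric.tendsto_nhds]
  intro ε hε
  set M := ∫ x, G x ∂μ with hM
  have hM0 : 0 ≤ M := integral_nonneg_of_ae hG0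
  -- The total masses of `F i` converge to `M` (the moment `k = 0`), so they are eventually below `M
  -- + 1`, and each polynomial replacement costs less than `ε / 3`.
  have hδ : 0 < ε / (3 * (M + 1)) := by positivity
  obtain ⟨q, hq⟩ := exists_polynomial_near_of_continuousOn 0 1 g hg.continuousOn _ hδ
  have hmass : Tendsto (fun i ↦ ∫ x, F i x ∂μ) l (𝓝 M) := by simpa using hmom 0
  filter_upwards [hmass.eventually_lt_const (lt_add_one M),
    Metric.tendsto_nhds.1 (hpoly q) (ε / 3) (by positivity)] with i hi hqi
  have h1 := hclose q _ hq (F i) (hF i) (hF0 i)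
  have h2 := hclose q _ hq G hG hG0
  have hb : ε / (3 * (M + 1)) * (M + 1) = ε / 3 := by field_simp
  have h3 : ε / (3 * (M + 1)) * ∫ x, F i x ∂μ < ε / 3 := by
    rw [← hb]; exact mul_lt_mul_of_pos_left hi hδ
  have h4 : ε / (3 * (M + 1)) * M < ε / 3 := by
    rw [← hb]; exact mul_lt_mul_of_pos_left (lt_add_one M) hδ
  rw [Real.dist_eq] at hqi ⊢
  rw [abs_lt] at hqi ⊢
  rw [abs_le] at h1 h2
  constructor <;> linarith [hqi.1, hqi.2, h1.1, h1.2, h2.1, h2.2]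

/-- The test function on `[0, 1]` which, composed with `y ↦ exp (-y)`, is supported in
`[a, b]`. -/
noncomputable def expBump (a b v : ℝ) : ℝ := max 0 ((v - Real.exp (-b)) * (Real.exp (-a) - v))

lemma continuous_expBump (a b : ℝ) : Continuous (expBump a b) := by
  unfold expBump; fun_prop

lemma expBump_nonneg (a b v : ℝ) : 0 ≤ expBump a b v := le_max_left _ _

lemma expBump_exp_neg_pos {a b y : ℝ} (hy : y ∈ Ioo a b) : 0 < expBump a b (Real.exp (-y)) :=
  lt_max_of_lt_right <| mul_pos (sub_pos.2 (Real.exp_lt_exp.2 (neg_lt_neg hy.2)))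
    (sub_pos.2 (Real.exp_lt_exp.2 (neg_lt_neg hy.1)))

lemma expBump_exp_neg_eq_zero {a b y : ℝ} (hab : a < b) (hy : y ∉ Ioo a b) :
    expBump a b (Real.exp (-y)) = 0 := by
  have hE : Real.exp (-b) < Real.exp (-a) := Real.exp_lt_exp.2 (neg_lt_neg hab)
  refine max_eq_left ?_
  rcases le_or_gt y a with h | h
  · have := Real.exp_le_exp.2 (neg_le_neg h)
    exact mul_nonpos_of_nonneg_of_nonpos (by linarith) (by linarith)
  · have := Real.exp_le_exp.2 (neg_le_neg (not_lt.1 fun h' ↦ hy ⟨h, h'⟩))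
    exact mul_nonpos_of_nonpos_of_nonneg (by linarith) (by linarith)

lemma integrableOn_exp_neg_mul_rpow_neg {α : ℝ} (hα : α < 1) {r : ℝ} (hr : 0 < r) :
    IntegrableOn (fun y : ℝ ↦ Real.exp (-r * y) * y ^ (-α)) (Ioi 0) := by
  have h := integrableOn_rpow_mul_exp_neg_mul_rpow (p := 1) (s := -α) (b := r) (by linarith)
    one_pos hr
  simpa only [Real.rpow_one, mul_comm] using h

/-- A Tauberian theorem: if nonnegative nonincreasing functions `F i` have Laplace transforms
converging, at every positive integer, to the Laplace transform of `c y ^ (-α)`, then `F i 1 → c`. -/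
lemma tendsto_apply_one_of_laplace {ι : Type*} {l : Filter ι} {α c : ℝ} (hα₀ : 0 ≤ α)
    (hα₁ : α < 1) (hc : 0 ≤ c) {F : ι → ℝ → ℝ} (hF : ∀ i, Antitone (F i)) (hF0 : ∀ i y, 0 ≤ F i y)
    (hlap : ∀ k : ℕ, Tendsto (fun i ↦ ∫ y in Ioi (0 : ℝ), Real.exp (-(k + 1 : ℝ) * y) * F i y) l
      (𝓝 (∫ y in Ioi (0 : ℝ), Real.exp (-(k + 1 : ℝ) * y) * (c * y ^ (-α))))) :
    Tendsto (fun i ↦ F i 1) l (𝓝 c) := by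
  have hFi : ∀ i, IntegrableOn (fun y ↦ Real.exp (-y) * F i y) (Ioi 0) := by
    intro i
    have h1 : IntegrableOn (fun y : ℝ ↦ Real.exp (-y) * F i 0) (Ioi 0) := by
      simpa [IntegrableOn] using (exp_neg_integrableOn_Ioi 0 one_pos).mul_const (F i 0)
    refine Integrable.mono' h1 (by have := (hF i).measurable; fun_prop)
      ((ae_restrict_iff' measurableSet_Ioi).2 <| .of_forall fun y hy ↦ ?_)
    rw [Real.norm_of_nonneg (mul_nonneg (Real.exp_pos _).le (hF0 i y))]
    exact mul_le_mul_of_nonneg_left (hF i hy.le) (Real.exp_pos _).le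
  have hGi : IntegrableOn (fun y : ℝ ↦ Real.exp (-y) * (c * y ^ (-α))) (Ioi 0) := by
    have h := (integrableOn_exp_neg_mul_rpow_neg hα₁ one_pos).const_mul c
    refine h.congr (.of_forall fun y ↦ ?_)
    simp only [neg_mul, one_mul]
    ring
  -- The weight `exp (-y)` makes the densities integrable; it also shifts the `k`-th moment of `exp
  -- (-y)` to the Laplace transform at `k + 1`.
  have hpow : ∀ (k : ℕ) (y z : ℝ),
      Real.exp (-y) ^ k * (Real.exp (-y) * z) = Real.exp (-(k + 1 : ℝ) * y) * z := by
    intro k y z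
    rw [← mul_assoc, ← pow_succ, ← Real.exp_nat_mul]
    push_cast
    ring_nf
  have key : ∀ a b : ℝ, Tendsto
      (fun i ↦ ∫ y in Ioi (0 : ℝ), expBump a b (Real.exp (-y)) * (Real.exp (-y) * F i y)) l
      (𝓝 (∫ y in Ioi (0 : ℝ), expBump a b (Real.exp (-y)) * (Real.exp (-y) * (c * y ^ (-α))))) := by
    intro a b
    refine tendsto_integral_comp_mul_of_moments (e := fun y ↦ Real.exp (-y)) (by fun_prop) ?_ hFi ?_
      hGi ?_ ?_ (continuous_expBump a b)
    · refine (ae_restrict_iff' measurableSet_Ioi).2 <| .of_forall fun y (hy : 0 < y) ↦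
        ⟨(Real.exp_pos _).le, Real.exp_le_one_iff.2 (by linarith)⟩
    · exact fun i ↦ .of_forall fun y ↦ mul_nonneg (Real.exp_pos _).le (hF0 i y)
    · exact (ae_restrict_iff' measurableSet_Ioi).2 <| .of_forall fun y (hy : 0 < y) ↦ by
        simp only [Pi.zero_apply]; positivity
    · intro k
      simp only [hpow]
      exact hlap k
  set w : ℝ → ℝ → ℝ → ℝ := fun a b y ↦ expBump a b (Real.exp (-y)) * Real.exp (-y) with hw
  have hw0 : ∀ a b y, 0 ≤ w a b y := fun a b y ↦
    mul_nonneg (expBump_nonneg _ _ _) (Real.exp_pos _).le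
  have hwz : ∀ a b y, a < b → y ∉ Ioo a b → w a b y = 0 := fun a b y hab hy ↦ by
    rw [hw]; simp only [expBump_exp_neg_eq_zero hab hy, zero_mul]
  have hwint : ∀ (a b : ℝ) (H : ℝ → ℝ), IntegrableOn (fun y ↦ Real.exp (-y) * H y) (Ioi 0) →
      IntegrableOn (fun y ↦ w a b y * H y) (Ioi 0) := by
    intro a b H hH
    obtain ⟨C, hC⟩ := isCompact_Icc.exists_bound_of_continuousOn
      ((continuous_expBump a b).continuousOn (s := Icc 0 1))
    simp only [hw, mul_assoc]
    refine Integrable.bdd_mul (c := C) hH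
      ((continuous_expBump a b).comp (by fun_prop)).aestronglyMeasurable
      ((ae_restrict_iff' measurableSet_Ioi).2 <| .of_forall fun y (hy : 0 < y) ↦ hC _
        ⟨(Real.exp_pos _).le, Real.exp_le_one_iff.2 (by linarith)⟩)
  have hexp1 : IntegrableOn (fun y : ℝ ↦ Real.exp (-y)) (Ioi 0) := by
    simpa using exp_neg_integrableOn_Ioi 0 one_pos
  have hwc : ∀ a b z : ℝ, IntegrableOn (fun y ↦ w a b y * z) (Ioi 0) := fun a b z ↦
    hwint a b (fun _ ↦ z) (hexp1.mul_const z)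
  have hwpos : ∀ a b : ℝ, 0 ≤ a → a < b → 0 < ∫ y in Ioi (0 : ℝ), w a b y := by
    intro a b ha hab
    rw [setIntegral_pos_iff_support_of_nonneg_ae (.of_forall (hw0 a b))
      (by simpa using hwc a b 1)]
    refine lt_of_lt_of_le ?_ (measure_mono (s := Ioo a b) fun y hy ↦
      ⟨(mul_pos (expBump_exp_neg_pos hy) (Real.exp_pos _)).ne', ha.trans_lt hy.1⟩)
    simpa using hab
  have key' : ∀ a b : ℝ, Tendsto (fun i ↦ ∫ y in Ioi (0 : ℝ), w a b y * F i y) l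
      (𝓝 (∫ y in Ioi (0 : ℝ), w a b y * (c * y ^ (-α)))) := by
    intro a b
    simpa only [hw, mul_assoc] using key a b
  -- comparison of the weighted integral of a function with its bounds on the support
  have hle : ∀ (a b z : ℝ) (H : ℝ → ℝ), a < b → IntegrableOn (fun y ↦ Real.exp (-y) * H y) (Ioi 0) →
      (∀ y ∈ Ioo a b, H y ≤ z) →
      ∫ y in Ioi (0 : ℝ), w a b y * H y ≤ z * ∫ y in Ioi (0 : ℝ), w a b y := by
    intro a b z H hab hH hz
    rw [mul_comm, ← integral_mul_const]
    refine integral_mono (hwint a b H hH) (hwc a b z) fun y ↦ ?_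
    by_cases hy : y ∈ Ioo a b
    · exact mul_le_mul_of_nonneg_left (hz y hy) (hw0 a b y)
    · simp only [hwz a b y hab hy, zero_mul, le_refl]
  have hge : ∀ (a b z : ℝ) (H : ℝ → ℝ), a < b → IntegrableOn (fun y ↦ Real.exp (-y) * H y) (Ioi 0) →
      (∀ y ∈ Ioo a b, z ≤ H y) →
      z * ∫ y in Ioi (0 : ℝ), w a b y ≤ ∫ y in Ioi (0 : ℝ), w a b y * H y := by
    intro a b z H hab hH hz
    rw [mul_comm, ← integral_mul_const]
    refine integral_mono (hwc a b z) (hwint a b H hH) fun y ↦ ?_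
    by_cases hy : y ∈ Ioo a b
    · exact mul_le_mul_of_nonneg_left (hz y hy) (hw0 a b y)
    · simp only [hwz a b y hab hy, zero_mul, le_refl]
  have hcont : ContinuousAt (fun b : ℝ ↦ c * b ^ (-α)) 1 :=
    (Real.continuousAt_rpow_const 1 (-α) (Or.inl one_ne_zero)).const_mul c
  have hcont1 : Tendsto (fun b : ℝ ↦ c * b ^ (-α)) (𝓝 1) (𝓝 c) := by
    simpa [ContinuousAt] using hcont
  refine tendsto_order.2 ⟨fun m hm ↦ ?_, fun m hm ↦ ?_⟩
  -- Lower bound: on `(1, b)` each `F i` is at most `F i 1`, while `c y ^ (-α) ≥ c b ^ (-α) > m`.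
  -- Bump averages over `(1, b)` transfer the inequality; the upper bound uses `(a, 1)` in the same
  -- way.
  · obtain ⟨b, hmb, hb⟩ := (((hcont1.mono_left nhdsWithin_le_nhds).eventually_const_lt hm).and
      (self_mem_nhdsWithin : Ioi (1 : ℝ) ∈ 𝓝[>] 1)).exists
    have hb : 1 < b := hb
    have hW := hwpos 1 b zero_le_one hb
    have hlim : m * ∫ y in Ioi (0 : ℝ), w 1 b y < ∫ y in Ioi (0 : ℝ), w 1 b y * (c * y ^ (-α)) :=
      (mul_lt_mul_of_pos_right hmb hW).trans_le <| hge 1 b _ _ hb hGi fun y hy ↦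
        mul_le_mul_of_nonneg_left
          (Real.rpow_le_rpow_of_nonpos (by linarith [hy.1]) hy.2.le (by linarith)) hc
    filter_upwards [(key' 1 b).eventually_const_lt hlim] with i hi
    exact lt_of_mul_lt_mul_right
      (hi.trans_le (hle 1 b (F i 1) (F i) hb (hFi i) fun y hy ↦ hF i hy.1.le)) hW.le
  · obtain ⟨a, ⟨hma, ha⟩, ha0⟩ := ((((hcont1.mono_left nhdsWithin_le_nhds).eventually_lt_const
      hm).and (self_mem_nhdsWithin : Iio (1 : ℝ) ∈ 𝓝[<] 1)).and
      (mem_nhdsWithin_of_mem_nhds (Ioi_mem_nhds zero_lt_one))).exists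
    have ha : a < 1 := ha
    have ha0 : 0 < a := ha0
    have hW := hwpos a 1 ha0.le ha
    have hlim : ∫ y in Ioi (0 : ℝ), w a 1 y * (c * y ^ (-α)) < m * ∫ y in Ioi (0 : ℝ), w a 1 y :=
      (hle a 1 _ _ ha hGi fun y hy ↦ mul_le_mul_of_nonneg_left
          (Real.rpow_le_rpow_of_nonpos ha0 hy.1.le (by linarith)) hc).trans_lt
        (mul_lt_mul_of_pos_right hma hW)
    filter_upwards [(key' a 1).eventually_lt_const hlim] with i hi
    exact lt_of_mul_lt_mul_right
      ((hge a 1 (F i 1) (F i) ha (hFi i) fun y hy ↦ hF i hy.2.le).trans_lt hi) hW.le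

end Tauberian

/-- Squeeze from `z exp (-z) ≤ 1 - exp (-z) ≤ z`, valid for all real `z`. -/
lemma tendsto_mul_one_sub_exp_neg {ι : Type*} {l : Filter ι} {a z : ι → ℝ} {L : ℝ}
    (ha : ∀ᶠ i in l, 0 ≤ a i) (hz : Tendsto z l (𝓝 0))
    (haz : Tendsto (fun i ↦ a i * z i) l (𝓝 L)) :
    Tendsto (fun i ↦ a i * (1 - Real.exp (-z i))) l (𝓝 L) := by
  have hlow : Tendsto (fun i ↦ a i * z i * Real.exp (-z i)) l (𝓝 L) := by
    simpa using haz.mul ((Real.continuous_exp.tendsto _).comp hz.neg)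
  refine tendsto_of_tendsto_of_tendsto_of_le_of_le' hlow haz ?_ ?_
  · filter_upwards [ha] with i hi
    rw [mul_assoc]
    refine mul_le_mul_of_nonneg_left ?_ hi
    have h1 := Real.add_one_le_exp (z i)
    have h2 : Real.exp (z i) * Real.exp (-z i) = 1 := by rw [← Real.exp_add]; simp
    nlinarith [Real.exp_pos (-z i)]
  · filter_upwards [ha] with i hi
    exact mul_le_mul_of_nonneg_left (by linarith [Real.add_one_le_exp (-z i)]) hi

/-! ### Scaling limits of the Laplace transform of the subordinator -/

section Subordinator

variable {Ω : Type*} [MeasurableSpace Ω] {P : Measure Ω} {α : ℝ} {S : ℝ≥0 → Ω → ℝ}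

lemma IsSubordinator.ae_nonneg (hS : IsSubordinator S P) (t : ℝ≥0) : ∀ᵐ ω ∂P, 0 ≤ S t ω := by
  filter_upwards [hS.zero, hS.monotone] with ω h0 hmono
  exact h0 ▸ hmono (zero_le (a := t))

namespace IsIncompleteGammaSubordinator

lemma integral_exp_neg_mul_div (hS : IsIncompleteGammaSubordinator α S P) (t : ℝ≥0) {η r : ℝ}
    (hη : 0 ≤ η) (hr : 0 ≤ r) :
    ∫ ω, Real.exp (-η * (S t ω / r)) ∂P
      = Real.exp (-((t : ℝ) * (α * lowerIncompleteGamma α (η / r)))) := by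
  have h := hS.laplaceExponent t (η / r) (by positivity)
  rw [neg_mul (t : ℝ)] at h
  rw [← h]
  refine integral_congr_ae (.of_forall fun ω ↦ ?_)
  ring_nf

lemma tendsto_rpow_mul_one_sub_exp (hα : 0 < α) (t : ℝ≥0) {κ : ℝ} (hκ : 0 ≤ κ) :
    Tendsto (fun x : ℝ ↦ x ^ α *
      (1 - Real.exp (-((t : ℝ) * (α * lowerIncompleteGamma α (κ / x)))))) atTop
      (𝓝 (t * κ ^ α)) := by
  refine tendsto_mul_one_sub_exp_neg ?_ ?_ ?_
  · filter_upwards [eventually_ge_atTop 0] with x hx using by positivity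
  · have hcont := ((continuous_lowerIncompleteGamma hα).tendsto 0).comp
      (tendsto_id.const_div_atTop κ : Tendsto (fun x : ℝ ↦ κ / x) atTop (𝓝 0))
    have h0 : lowerIncompleteGamma α 0 = 0 := by simp [lowerIncompleteGamma]
    rw [h0] at hcont
    simpa using (hcont.const_mul α).const_mul (t : ℝ)
  · simpa only [mul_left_comm] using
      (tendsto_rpow_mul_mul_lowerIncompleteGamma hα hκ).const_mul (t : ℝ)

variable [IsProbabilityMeasure P]

/-! ### Tail asymptotics -/

lemma tendsto_rpow_mul_measureReal_lt (hS : IsIncompleteGammaSubordinator α S P) (hα₀ : 0 < α)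
    (hα₁ : α < 1) (t : ℝ≥0) :
    Tendsto (fun x : ℝ ↦ x ^ α * P.real {ω | x < S t ω}) atTop
      (𝓝 (t / Real.Gamma (1 - α))) := by
  have hΓ : 0 < Real.Gamma (1 - α) := Real.Gamma_pos_of_pos (by linarith)
  -- The absolute value keeps the family nonnegative and antitone in `y` for every real index `x`,
  -- negative ones included.
  have hmain : Tendsto (fun x : ℝ ↦ |x| ^ α * P.real {ω | 1 < S t ω / x}) atTop
      (𝓝 (t / Real.Gamma (1 - α))) := by
    refine tendsto_apply_one_of_laplace (F := fun x y ↦ |x| ^ α * P.real {ω | y < S t ω / x})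
      hα₀.le hα₁ (by positivity)
      (fun x y z hyz ↦ mul_le_mul_of_nonneg_left
        (measureReal_mono fun ω hω ↦ lt_of_le_of_lt hyz hω) (by positivity))
      (fun x y ↦ by positivity) fun k ↦ ?_
    have hk : (0 : ℝ) < k + 1 := by positivity
    have hrhs : ∫ y in Set.Ioi (0 : ℝ), Real.exp (-(k + 1 : ℝ) * y) *
        (t / Real.Gamma (1 - α) * y ^ (-α)) = (t : ℝ) * (k + 1 : ℝ) ^ α / (k + 1) := by
      have h := Real.integral_rpow_mul_exp_neg_mul_Ioi (a := 1 - α) (by linarith) hk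
      rw [show 1 - α - 1 = -α by ring] at h
      calc _ = t / Real.Gamma (1 - α) *
            ∫ y in Set.Ioi (0 : ℝ), y ^ (-α) * Real.exp (-((k + 1 : ℝ) * y)) := by
            rw [← integral_const_mul]
            refine integral_congr_ae (.of_forall fun y ↦ ?_)
            simp only [neg_mul]
            ring
        _ = _ := by
            rw [h, Real.div_rpow zero_le_one hk.le, Real.one_rpow, Real.rpow_sub hk,
              Real.rpow_one]
            field_simp
    rw [hrhs]
    refine ((tendsto_rpow_mul_one_sub_exp hα₀ t hk.le).div_const (k + 1 : ℝ)).congr' ?_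
    filter_upwards [eventually_gt_atTop 0] with x hx
    simp only [mul_left_comm (Real.exp _)]
    rw [integral_const_mul, integral_exp_neg_mul_measureReal_lt ((hS.measurable t).div_const x)
      ((hS.ae_nonneg t).mono fun ω hω ↦ div_nonneg hω hx.le) hk,
      hS.integral_exp_neg_mul_div t hk.le hx.le, abs_of_pos hx, mul_div_assoc]
  refine hmain.congr' ?_
  filter_upwards [eventually_gt_atTop 0] with x hx
  simp only [abs_of_pos hx, one_lt_div hx]

theorem isEquivalent_measureReal_lt (hS : IsIncompleteGammaSubordinator α S P) (hα₀ : 0 < α)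
    (hα₁ : α < 1) (t : ℝ≥0) :
    (fun x : ℝ ↦ P.real {ω | x < S t ω}) ~[atTop]
      (fun x : ℝ ↦ (t : ℝ) * x ^ (-α) / Real.Gamma (1 - α)) := by
  have hΓ : 0 < Real.Gamma (1 - α) := Real.Gamma_pos_of_pos (by linarith)
  -- At `t = 0` the comparison function vanishes and the ratio criterion fails; there both sides are
  -- eventually zero.
  obtain rfl | ht := eq_or_ne t 0
  · refine EventuallyEq.isEquivalent ?_
    filter_upwards [eventually_ge_atTop 0] with x hx
    have hnull : P {ω | x < S 0 ω} = 0 := by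
      rw [← compl_mem_ae_iff]
      filter_upwards [hS.zero] with ω hω
      simpa [hω] using hx
    simp [measureReal_def, hnull]
  · have ht : (0 : ℝ) < t := by exact_mod_cast pos_iff_ne_zero.2 ht
    refine (isEquivalent_iff_tendsto_one ?_).2 ?_
    · filter_upwards [eventually_gt_atTop 0] with x hx
      positivity
    · have h := (hS.tendsto_rpow_mul_measureReal_lt hα₀ hα₁ t).div_const
        (t / Real.Gamma (1 - α))
      rw [div_self (by positivity)] at h
      refine h.congr' ?_
      filter_upwards [eventually_gt_atTop 0] with x hx
      simp only [Pi.div_apply]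
      rw [Real.rpow_neg hx.le]
      field_simp

/-! ### Fractional moments -/

lemma lintegral_rpow_eq (hS : IsIncompleteGammaSubordinator α S P) (t : ℝ≥0) {p r : ℝ}
    (hp : 0 < p) (hp1 : p < 1) (hr : 0 ≤ r) :
    ENNReal.ofReal (Real.Gamma (1 - p) / p) * ∫⁻ ω, ENNReal.ofReal ((S t ω / r) ^ p) ∂P
      = ∫⁻ η in Set.Ioi (0 : ℝ), ENNReal.ofReal
        ((1 - Real.exp (-((t : ℝ) * (α * lowerIncompleteGamma α (η / r))))) * η ^ (-p - 1)) := by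
  rw [lintegral_rpow_eq_lintegral_laplace ((hS.measurable t).div_const r)
    ((hS.ae_nonneg t).mono fun ω hω ↦ div_nonneg hω hr) hp hp1]
  refine setLIntegral_congr_fun measurableSet_Ioi fun η (hη : 0 < η) ↦ ?_
  simp only [hS.integral_exp_neg_mul_div t hη.le hr]

/-- Domination by the stable integrand. Taking `r = 1` yields finiteness of the moments; for `t >
0`, `r = t ^ α⁻¹` makes the bound independent of `t`. -/
lemma one_sub_exp_mul_le (hα : 0 < α) (t : ℝ≥0) {p η r : ℝ} (hη : 0 < η) (hr : 0 < r) :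
    (1 - Real.exp (-((t : ℝ) * (α * lowerIncompleteGamma α (η / r))))) * η ^ (-p - 1)
      ≤ (1 - Real.exp (-(t / r ^ α * η ^ α))) * η ^ (-p - 1) := by
  refine mul_le_mul_of_nonneg_right (sub_le_sub_left (Real.exp_le_exp.2 (neg_le_neg ?_)) _)
    (by positivity)
  rw [div_mul_eq_mul_div, mul_div_assoc, ← Real.div_rpow hη.le hr.le]
  exact mul_le_mul_of_nonneg_left (mul_lowerIncompleteGamma_le hα (by positivity)) t.2

theorem integrable_rpow (hS : IsIncompleteGammaSubordinator α S P) (hα₀ : 0 < α) (hα₁ : α ≤ 1)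
    {p : ℝ} (hp : 0 < p) (hpα : p < α) (t : ℝ≥0) : Integrable (fun ω ↦ S t ω ^ p) P := by
  have hΓ : 0 < Real.Gamma (1 - p) := Real.Gamma_pos_of_pos (by linarith)
  have heq := hS.lintegral_rpow_eq t hp (hpα.trans_le hα₁) zero_le_one
  simp only [div_one] at heq
  have hfin : ENNReal.ofReal (Real.Gamma (1 - p) / p) * ∫⁻ ω, ENNReal.ofReal (S t ω ^ p) ∂P < ⊤ := by
    rw [heq]
    refine lt_of_le_of_lt (setLIntegral_mono' measurableSet_Ioi fun η (hη : 0 < η) ↦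
      ENNReal.ofReal_le_ofReal (by simpa using one_sub_exp_mul_le hα₀ t (p := p) hη one_pos)) ?_
    rw [lintegral_one_sub_exp_neg_mul_rpow hp hpα t.coe_nonneg]
    exact ENNReal.ofReal_lt_top
  refine ⟨((hS.measurable t).pow_const p).aestronglyMeasurable, ?_⟩
  rw [hasFiniteIntegral_iff_ofReal
    ((hS.ae_nonneg t).mono fun ω hω ↦ Real.rpow_nonneg hω p)]
  refine lt_top_iff_ne_top.2 fun htop ↦ ?_
  rw [htop, ENNReal.mul_top (by simpa using div_pos hΓ hp)] at hfin
  exact lt_irrefl _ hfin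

lemma tendsto_integral_div_rpow (hS : IsIncompleteGammaSubordinator α S P) (hα₀ : 0 < α)
    (hα₁ : α ≤ 1) {p : ℝ} (hp : 0 < p) (hpα : p < α) :
    Tendsto (fun t : ℝ≥0 ↦ ∫ ω, (S t ω / (t : ℝ) ^ α⁻¹) ^ p ∂P) atTop
      (𝓝 (Real.Gamma (1 - p / α) / Real.Gamma (1 - p))) := by
  have hΓ : 0 < Real.Gamma (1 - p) := Real.Gamma_pos_of_pos (by linarith)
  have hΓ' : 0 < Real.Gamma (1 - p / α) :=
    Real.Gamma_pos_of_pos (by linarith [(div_lt_one hα₀).2 hpα])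
  have hlimint := lintegral_one_sub_exp_neg_mul_rpow hp hpα zero_le_one
  simp only [one_mul, Real.one_rpow, mul_one] at hlimint
  have hscale : Tendsto (fun t : ℝ≥0 ↦ (t : ℝ) ^ α⁻¹) atTop atTop :=
    (tendsto_rpow_atTop (inv_pos.2 hα₀)).comp (NNReal.tendsto_coe_atTop.2 tendsto_id)
  have hpow : ∀ t : ℝ≥0, ((t : ℝ) ^ α⁻¹) ^ α = t := fun t ↦ Real.rpow_inv_rpow t.2 hα₀.ne'
  have hlim : Tendsto (fun t : ℝ≥0 ↦ ENNReal.ofReal (Real.Gamma (1 - p) / p) *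
      ∫⁻ ω, ENNReal.ofReal ((S t ω / (t : ℝ) ^ α⁻¹) ^ p) ∂P) atTop
      (𝓝 (ENNReal.ofReal (Real.Gamma (1 - p / α) / p))) := by
    simp only [hS.lintegral_rpow_eq _ hp (hpα.trans_le hα₁)
      (Real.rpow_nonneg (NNReal.coe_nonneg _) _)]
    rw [← hlimint]
    -- The limit integrand is itself the dominating function.
    refine tendsto_lintegral_filter_of_dominated_convergence _
      (.of_forall fun t ↦ ?_) ?_ (hlimint ▸ ENNReal.ofReal_ne_top) ?_
    · have := (continuous_lowerIncompleteGamma hα₀).measurable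
      fun_prop
    · filter_upwards [eventually_gt_atTop 0] with t ht
      refine (ae_restrict_iff' measurableSet_Ioi).2 <| .of_forall fun η (hη : 0 < η) ↦ ?_
      have ht : (0 : ℝ) < t := by exact_mod_cast ht
      have h := one_sub_exp_mul_le hα₀ t (p := p) hη (Real.rpow_pos_of_pos ht α⁻¹)
      rw [hpow, div_self ht.ne', one_mul] at h
      exact ENNReal.ofReal_le_ofReal h
    · refine (ae_restrict_iff' measurableSet_Ioi).2 <| .of_forall fun η (hη : 0 < η) ↦ ?_
      have h := (tendsto_rpow_mul_mul_lowerIncompleteGamma hα₀ hη.le).comp hscale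
      simp only [Function.comp_def, hpow] at h
      exact ENNReal.tendsto_ofReal
        ((((Real.continuous_exp.tendsto _).comp h.neg).const_sub 1).mul_const _)
  have hreal := (ENNReal.tendsto_toReal ENNReal.ofReal_ne_top).comp hlim
  rw [ENNReal.toReal_ofReal (by positivity)] at hreal
  have hdiv := hreal.div_const (Real.Gamma (1 - p) / p)
  rw [show Real.Gamma (1 - p / α) / p / (Real.Gamma (1 - p) / p)
    = Real.Gamma (1 - p / α) / Real.Gamma (1 - p) by field_simp] at hdiv
  refine hdiv.congr fun t ↦ ?_
  have hintegrable : 0 ≤ᵐ[P] fun ω ↦ (S t ω / (t : ℝ) ^ α⁻¹) ^ p :=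
    (hS.ae_nonneg t).mono fun ω hω ↦ Real.rpow_nonneg (div_nonneg hω (by positivity)) p
  rw [integral_eq_lintegral_of_nonneg_ae hintegrable
    (((hS.measurable t).div_const _).pow_const p).aestronglyMeasurable]
  simp only [Function.comp_apply, ENNReal.toReal_mul]
  rw [ENNReal.toReal_ofReal (by positivity), mul_div_cancel_left₀ _ (by positivity)]

theorem isEquivalent_integral_rpow (hS : IsIncompleteGammaSubordinator α S P) (hα₀ : 0 < α)
    (hα₁ : α ≤ 1) {p : ℝ} (hp : 0 < p) (hpα : p < α) :
    (fun t : ℝ≥0 ↦ ∫ ω, S t ω ^ p ∂P) ~[atTop]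
      (fun t : ℝ≥0 ↦ Real.Gamma (1 - p / α) / Real.Gamma (1 - p) * (t : ℝ) ^ (p / α)) := by
  have hΓ : 0 < Real.Gamma (1 - p) := Real.Gamma_pos_of_pos (by linarith)
  have hΓ' : 0 < Real.Gamma (1 - p / α) :=
    Real.Gamma_pos_of_pos (by linarith [(div_lt_one hα₀).2 hpα])
  refine (isEquivalent_iff_tendsto_one ?_).2 ?_
  · filter_upwards [eventually_gt_atTop 0] with t ht
    have ht : (0 : ℝ) < t := by exact_mod_cast ht
    positivity
  · have h := (hS.tendsto_integral_div_rpow hα₀ hα₁ hp hpα).div_const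
      (Real.Gamma (1 - p / α) / Real.Gamma (1 - p))
    rw [div_self (by positivity)] at h
    refine h.congr' ?_
    filter_upwards [eventually_gt_atTop 0] with t ht
    have ht : (0 : ℝ) < t := by exact_mod_cast ht
    have hsplit : ∫ ω, (S t ω / (t : ℝ) ^ α⁻¹) ^ p ∂P
        = (∫ ω, S t ω ^ p ∂P) / (t : ℝ) ^ (p / α) := by
      rw [← integral_div]
      refine integral_congr_ae ?_
      filter_upwards [hS.ae_nonneg t] with ω hω
      rw [Real.div_rpow hω (by positivity), ← Real.rpow_mul ht.le, inv_mul_eq_div]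
    rw [hsplit, Pi.div_apply]
    field_simp

/-! ### The mean in the case `α = 1` -/

lemma tendsto_mul_one_sub_exp_neg_div (s : ℝ) :
    Tendsto (fun x : ℝ ↦ x * (1 - Real.exp (-1 * (s / x)))) atTop (𝓝 s) := by
  simp only [neg_one_mul]
  refine tendsto_mul_one_sub_exp_neg (eventually_ge_atTop 0) (tendsto_id.const_div_atTop s)
    (tendsto_const_nhds.congr' ?_)
  filter_upwards [eventually_gt_atTop 0] with x hx
  field_simp

/-- The mean of `S_1(t)` exists and equals `t`. -/
theorem integrable_and_integral_eq (hS : IsIncompleteGammaSubordinator 1 S P) (t : ℝ≥0) :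
    Integrable (S t) P ∧ ∫ ω, S t ω ∂P = t := by
  have hYm : ∀ x : ℝ, Measurable fun ω ↦ S t ω / x := fun x ↦ (hS.measurable t).div_const x
  have hY0 : ∀ x : ℝ, 0 < x → ∀ᵐ ω ∂P, 0 ≤ S t ω / x := fun x hx ↦
    (hS.ae_nonneg t).mono fun ω hω ↦ div_nonneg hω hx.le
  have hlap : Tendsto (fun x : ℝ ↦ x * (1 - ∫ ω, Real.exp (-1 * (S t ω / x)) ∂P)) atTop
      (𝓝 (t : ℝ)) := by
    have h := tendsto_rpow_mul_one_sub_exp one_pos t zero_le_one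
    simp only [Real.rpow_one, mul_one] at h
    refine h.congr' ?_
    filter_upwards [eventually_gt_atTop 0] with x hx
    rw [hS.integral_exp_neg_mul_div t zero_le_one hx.le]
  have hintegrable : Integrable (S t) P := by
    refine ⟨(hS.measurable t).aestronglyMeasurable, ?_⟩
    rw [hasFiniteIntegral_iff_ofReal (hS.ae_nonneg t)]
    -- Fatou, applied to `x (1 - exp (-S / x)) → S`, gives integrability first; `S t` can then
    -- dominate the same family, which identifies the mean.
    calc ∫⁻ ω, ENNReal.ofReal (S t ω) ∂P
        = ∫⁻ ω, liminf (fun x : ℝ ↦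
            ENNReal.ofReal (x * (1 - Real.exp (-1 * (S t ω / x))))) atTop ∂P :=
          lintegral_congr fun ω ↦
            (ENNReal.tendsto_ofReal (tendsto_mul_one_sub_exp_neg_div (S t ω))).liminf_eq.symm
      _ ≤ liminf (fun x : ℝ ↦ ∫⁻ ω,
            ENNReal.ofReal (x * (1 - Real.exp (-1 * (S t ω / x)))) ∂P) atTop :=
          lintegral_liminf_le fun x ↦ by have := hYm x; fun_prop
      _ = ENNReal.ofReal t := by
          refine Tendsto.liminf_eq ((ENNReal.tendsto_ofReal hlap).congr' ?_)
          filter_upwards [eventually_gt_atTop 0] with x hx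
          simp only [ENNReal.ofReal_mul hx.le]
          rw [lintegral_const_mul _ (by have := hYm x; fun_prop),
            lintegral_one_sub_exp_neg_mul (hYm x) (hY0 x hx) zero_le_one]
      _ < ⊤ := ENNReal.ofReal_lt_top
  refine ⟨hintegrable, tendsto_nhds_unique (f := fun x : ℝ ↦
    ∫ ω, x * (1 - Real.exp (-1 * (S t ω / x))) ∂P) (l := atTop) ?_ ?_⟩
  · refine tendsto_integral_filter_of_dominated_convergence (S t)
      (.of_forall fun x ↦ by have := hYm x; fun_prop) ?_ hintegrable
      (.of_forall fun ω ↦ tendsto_mul_one_sub_exp_neg_div (S t ω))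
    filter_upwards [eventually_gt_atTop 0] with x hx
    filter_upwards [hS.ae_nonneg t] with ω hω
    rw [Real.norm_of_nonneg (mul_nonneg hx.le
      (one_sub_exp_neg_mul_nonneg zero_le_one (div_nonneg hω hx.le)))]
    calc x * (1 - Real.exp (-1 * (S t ω / x))) ≤ x * (S t ω / x) :=
          mul_le_mul_of_nonneg_left
            (by linarith [Real.add_one_le_exp (-1 * (S t ω / x))]) hx.le
      _ = S t ω := mul_div_cancel₀ _ hx.ne'
  · refine hlap.congr' ?_
    filter_upwards [eventually_gt_atTop 0] with x hx
    rw [integral_const_mul, integral_one_sub_exp_neg_mul (hYm x) (hY0 x hx) zero_le_one]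

end IsIncompleteGammaSubordinator

end Subordinator

theorem theorem2 {Ω : Type*} [MeasurableSpace Ω] (P : Measure Ω) [IsProbabilityMeasure P]
    (α : ℝ) (hα₀ : 0 < α) (hα₁ : α ≤ 1) (S : ℝ≥0 → Ω → ℝ)
    (hS : IsIncompleteGammaSubordinator α S P) :
    (α < 1 → ∀ t : ℝ≥0,
      (fun x : ℝ ↦ P.real {ω | x < S t ω}) ~[atTop]
        (fun x : ℝ ↦ (t : ℝ) * x ^ (-α) / Real.Gamma (1 - α))) ∧
    (∀ p : ℝ, 0 < p → p < α →
      (∀ t : ℝ≥0, Integrable (fun ω ↦ S t ω ^ p) P) ∧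
      (fun t : ℝ≥0 ↦ ∫ ω, S t ω ^ p ∂P) ~[atTop]
        (fun t : ℝ≥0 ↦ Real.Gamma (1 - p / α) / Real.Gamma (1 - p) * (t : ℝ) ^ (p / α))) ∧
    (α = 1 →
      (∀ t : ℝ≥0, Integrable (S t) P) ∧
      (fun t : ℝ≥0 ↦ ∫ ω, S t ω ∂P) ~[atTop] (fun t : ℝ≥0 ↦ (t : ℝ))) := by

  refine ⟨fun hα t ↦ hS.isEquivalent_measureReal_lt hα₀ hα t, fun p hp hpα ↦
    ⟨hS.integrable_rpow hα₀ hα₁ hp hpα, hS.isEquivalent_integral_rpow hα₀ hα₁ hp hpα⟩, ?_⟩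
  rintro rfl
  exact ⟨fun t ↦ (hS.integrable_and_integral_eq t).1,
    (EventuallyEq.of_eq (funext fun t ↦ (hS.integrable_and_integral_eq t).2)).isEquivalent⟩
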